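/- Let $n\ge 1$, $\lambda_p>0$, $\lambda_d\ge 0$, $r_d\ge 0$. Let $\Phi$ be a Matérn cluster process on $\mathbb{R}^n$: the parent points $X_1,X_2,\dots$ form a homogeneous Poisson point process on $\mathbb{R}^n$ of intensity $\lambda_p$; to the parent points one associates daughter point processes $\Phi_1,\Phi_2,\dots$, independent of each other and of the parents, each of them a Poisson point process with intensity function $\lambda_d\,\mathbf{1}(\|y\|\le r_d)$; and $\Phi=\bigcup_i (X_i+\Phi_i)$, where point processes are regarded as random counting measures (so the union is the sum of the counting measures). For $r\ge 0$ let $N$ be the number of points of $\Phi$ in the closed ball $\mathcal{B}(o,r)$ of radius $r$ about the origin. Let $v_n=\pi^{n/2}/\Gamma(\frac n2+1)$ be the volume of the unit ball of $\mathbb{R}^n$, and let $\mathcal{A}(r,r_d,x)$ be the volume of the intersection of $\mathcal{B}(o,r)$ with a ball of radius $r_d$ whose centre has norm $x$. Then $N$ is almost surely finite and, for every real $s$, the random variable $s^N$ (with $0^0=1$) is integrable and the probability generating function of $N$ is $$\mathbb{E}[s^N]=\exp(g(s)),\qquad g(s)=v_n\lambda_p\left(\int_0^{r+r_d} n\,e^{\lambda_d\mathcal{A}(r,r_d,x)(s-1)}\,x^{n-1}\,dx-(r+r_d)^n\right).$$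 -/

import Mathlib

open MeasureTheory ProbabilityTheory Metric
open scoped ENNReal NNReal

noncomputable section

namespace MaternCluster

/-- A locally finite counting measure: it is finite and integer valued on every bounded
Borel set. A point configuration is identified with the measure counting its points. -/
def IsPointConfiguration {E : Type*} [PseudoMetricSpace E] [MeasurableSpace E]
    (m : Measure E) : Prop :=
  ∀ B : Set E, MeasurableSet B → Bornology.IsBounded B → ∃ k : ℕ, m B = (k : ℝ≥0∞)

/-- `η` is a point process on `E` (a random locally finite counting measure on the
probability space `(Ω, P)`) which is Poisson with intensity measure `Λ`: the number of points
in a Borel set `B` with `Λ B < ∞` is Poisson distributed with mean `Λ B`, and the numbers of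
points in pairwise disjoint Borel sets are independent. -/
structure IsPoissonProcess {Ω E : Type*} [MeasurableSpace Ω] [PseudoMetricSpace E]
    [MeasurableSpace E] (P : Measure Ω) (Λ : Measure E) (η : Ω → Measure E) : Prop where
  measurable : Measurable η
  isPointConfiguration : ∀ᵐ ω ∂P, IsPointConfiguration (η ω)
  hasLaw : ∀ B : Set E, MeasurableSet B → Λ B < ∞ →
    HasLaw (fun ω => η ω B)
      ((poissonMeasure (Λ B).toNNReal).map (fun k : ℕ => (k : ℝ≥0∞))) P
  indep : ∀ (k : ℕ) (B : Fin k → Set E), (∀ i, MeasurableSet (B i)) →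
    Pairwise (fun i j => Disjoint (B i) (B j)) →
    iIndepFun (fun (i : Fin k) (ω : Ω) => η ω (B i)) P

/-- The superposition `⋃ᵢ (X i + D i)` of the clusters `D i` translated to the parent points
`X i`, as a counting measure. -/
def clusterUnion {E : Type*} [AddGroup E] [MeasurableSpace E]
    (X : ℕ → E) (D : ℕ → Measure E) : Measure E :=
  Measure.sum fun i => (D i).map (fun y => X i + y)

/-- `Φ` is a Matérn cluster process on `ℝⁿ`: the parent points `X i` form a homogeneous Poisson
process of intensity `lamP`; the daughter processes `D i` are independent Poisson processes of
intensity `lamD` on the ball `B(o, rd)`, independent of the parents; and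
`Φ = ⋃ᵢ (X i + D i)`. -/
def IsMaternClusterProcess {Ω : Type*} [MeasurableSpace Ω] {n : ℕ} (P : Measure Ω)
    (lamP lamD rd : ℝ) (Φ : Ω → Measure (EuclideanSpace ℝ (Fin n))) : Prop :=
  ∃ (X : ℕ → Ω → EuclideanSpace ℝ (Fin n)) (D : ℕ → Ω → Measure (EuclideanSpace ℝ (Fin n))),
    (∀ i, Measurable (X i)) ∧
    IsPoissonProcess P (ENNReal.ofReal lamP • volume)
      (fun ω => Measure.sum fun i => Measure.dirac (X i ω)) ∧
    (∀ i, IsPoissonProcess P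
      (ENNReal.ofReal lamD • volume.restrict (closedBall 0 rd)) (D i)) ∧
    iIndepFun D P ∧
    IndepFun (fun ω i => X i ω) (fun ω i => D i ω) P ∧
    ∀ᵐ ω ∂P, Φ ω = clusterUnion (fun i => X i ω) (fun i => D i ω)

/-- The number of points of the configuration `m` in `B`, as a natural number. It is only used
where `m B` is a natural number almost surely, and then it equals `m B`. -/
def pointCount {E : Type*} [MeasurableSpace E] (m : Measure E) (B : Set E) : ℕ :=
  ⌊(m B).toReal⌋₊

/-- The volume `v_n = π ^ (n / 2) / Γ(n / 2 + 1)` of the unit ball of `ℝⁿ`. -/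
def unitBallVolume (n : ℕ) : ℝ :=
  Real.pi ^ ((n : ℝ) / 2) / Real.Gamma ((n : ℝ) / 2 + 1)

/-- `𝒜(r, rd, x)`: the volume of the intersection of the balls `B(o, r)` and `B(c, rd)` of `ℝⁿ`,
where `c` is a point with `‖c‖ = x`; the point `c = (x, 0, …, 0)` is taken. -/
def interVolume (n : ℕ) [NeZero n] (r rd x : ℝ) : ℝ :=
  (volume : Measure (EuclideanSpace ℝ (Fin n))).real
    (closedBall 0 r ∩ closedBall (EuclideanSpace.single (0 : Fin n) x) rd)

/-- The choice of the second centre in `interVolume` does not matter. -/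
theorem interVolume_norm (n : ℕ) [NeZero n] (r rd : ℝ) (c : EuclideanSpace ℝ (Fin n)) :
    (volume : Measure (EuclideanSpace ℝ (Fin n))).real (closedBall 0 r ∩ closedBall c rd) =
      interVolume n r rd ‖c‖ := by
  set d : EuclideanSpace ℝ (Fin n) := EuclideanSpace.single (0 : Fin n) ‖c‖ with hd
  have hnorm : ‖d‖ = ‖c‖ := by simp [hd]
  set e := (ℝ ∙ (d - c))ᗮ.reflection with he
  have hdc : e d = c := Submodule.reflection_sub hnorm
  have hpre : e ⁻¹' (closedBall 0 r ∩ closedBall c rd) = closedBall 0 r ∩ closedBall d rd := by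
    rw [Set.preimage_inter, ← hdc, e.preimage_closedBall, e.preimage_closedBall]
    simp
  have hmp := e.measurePreserving
  rw [interVolume, ← hd, ← hpre, Measure.real, Measure.real,
    hmp.measure_preimage (measurableSet_closedBall.inter measurableSet_closedBall).nullMeasurableSet]

/-- The exponent `g(s)` of the probability generating function. -/
def exponent (n : ℕ) [NeZero n] (lamP lamD rd r s : ℝ) : ℝ :=
  unitBallVolume n * lamP *
    ((∫ x in (0 : ℝ)..(r + rd),
        (n : ℝ) * Real.exp (lamD * interVolume n r rd x * (s - 1)) * x ^ (n - 1)) -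
      (r + rd) ^ n)

end MaternCluster

end

/-
Condition on the parents. Almost surely only finitely many of them lie in `B(o, r + rd)`, and only
their clusters can reach `B(o, r)`, so the count is a finite sum of independent Poisson variables:
it is Poisson with mean `∑ᵢ c (X i)`, where `c x` is the mean number of points that a cluster
translated to `x` has in `B(o, r)`. Hence `E[s ^ N] = E[exp (∑ᵢ (s - 1) c (X i))]`, and the
exponential functional of the Poisson process of parents turns this into
`exp (∫ (exp ((s - 1) c x) - 1) dΛ x)`. In the Matérn case `c x = lamD * 𝒜(r, rd, ‖x‖)` is radial
and vanishes outside `B(o, r + rd)`, so polar coordinates give the exponent.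
-/

namespace MaternCluster

open Filter
open scoped Topology

section PoissonLaw

theorem hasSum_poisson_mul_pow (c : ℝ≥0) (a : ℝ) :
    HasSum (fun k : ℕ => Real.exp (-c) * c ^ k / (k.factorial : ℝ) * a ^ k)
      (Real.exp (c * (a - 1))) := by
  have h := (NormedSpace.expSeries_div_hasSum_exp ((c : ℝ) * a)).mul_left (Real.exp (-c))
  rw [← Real.exp_eq_exp_ℝ, ← Real.exp_add] at h
  convert! h using 1
  · ext k
    rw [mul_pow]
    ring
  · ring_nf

theorem integrable_pow_poissonMeasure (c : ℝ≥0) (a : ℝ) :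
    Integrable (fun k : ℕ => a ^ k) (poissonMeasure c) := by
  rw [integrable_poissonMeasure_iff]
  simpa only [norm_pow, Real.norm_eq_abs, smul_eq_mul] using (hasSum_poisson_mul_pow c |a|).summable

theorem integral_pow_poissonMeasure (c : ℝ≥0) (a : ℝ) :
    ∫ k : ℕ, a ^ k ∂(poissonMeasure c) = Real.exp (c * (a - 1)) := by
  rw [integral_poissonMeasure]
  exact (hasSum_poisson_mul_pow c a).tsum_eq

theorem poissonMeasure_zero : poissonMeasure 0 = Measure.dirac 0 := by
  refine Measure.ext_of_singleton fun k => ?_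
  rcases eq_or_ne k 0 with rfl | hk
  · simp [poissonMeasure_singleton]
  · simp [poissonMeasure_singleton, hk, hk.symm]

theorem map_natCast_poissonMeasure_zero : Po(ℝ≥0∞, 0) = Measure.dirac 0 := by
  rw [poissonMeasure_zero, Measure.map_dirac' .of_discrete, Nat.cast_zero]

variable {Ω : Type*} [MeasurableSpace Ω] {P : Measure Ω} {V : Ω → ℝ≥0∞} {c : ℝ≥0}

theorem hasLaw_floor_toReal_poisson (hV : HasLaw V Po(ℝ≥0∞, c) P) :
    HasLaw (fun ω => ⌊(V ω).toReal⌋₊) (poissonMeasure c) P := by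
  have hfloor : Measurable fun x : ℝ≥0∞ => ⌊x.toReal⌋₊ :=
    Nat.measurable_floor.comp ENNReal.measurable_toReal
  refine HasLaw.fun_comp (μ := Po(ℝ≥0∞, c)) ⟨hfloor.aemeasurable, ?_⟩ hV
  rw [Measure.map_map hfloor .of_discrete]
  convert! Measure.map_id
  simp [Function.comp_def, funext_iff]

theorem ae_eq_floor_toReal_of_hasLaw (hV : HasLaw V Po(ℝ≥0∞, c) P) :
    ∀ᵐ ω ∂P, V ω = (⌊(V ω).toReal⌋₊ : ℝ≥0∞) := by
  have hs : MeasurableSet {x : ℝ≥0∞ | x = (⌊x.toReal⌋₊ : ℝ≥0∞)} :=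
    measurableSet_eq_fun measurable_id (by fun_prop)
  rw [hV.ae_iff (measurableSet_setOfPred.1 hs), ae_map_iff .of_discrete hs]
  exact .of_forall fun k => by simp

theorem integrable_pow_floor_of_hasLaw (hV : HasLaw V Po(ℝ≥0∞, c) P) (a : ℝ) :
    Integrable (fun ω => a ^ ⌊(V ω).toReal⌋₊) P := by
  have hN := hasLaw_floor_toReal_poisson hV
  refine Integrable.comp_aemeasurable (f := fun ω => ⌊(V ω).toReal⌋₊) ?_ hN.aemeasurable
  rw [hN.map_eq]
  exact integrable_pow_poissonMeasure c a

theorem integral_pow_floor_of_hasLaw (hV : HasLaw V Po(ℝ≥0∞, c) P) (a : ℝ) :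
    ∫ ω, a ^ ⌊(V ω).toReal⌋₊ ∂P = Real.exp (c * (a - 1)) :=
  ((hasLaw_floor_toReal_poisson hV).integral_comp
    (Measurable.of_discrete (f := fun k => a ^ k)).aestronglyMeasurable).trans
    (integral_pow_poissonMeasure c a)

theorem ae_eq_zero_of_hasLaw_poisson_zero (hV : HasLaw V Po(ℝ≥0∞, 0) P) : V =ᵐ[P] 0 := by
  rw [map_natCast_poissonMeasure_zero] at hV
  exact hV.ae_eq_of_dirac

theorem hasLaw_finsetSum_poisson {ι : Type*} {V : ι → Ω → ℝ≥0∞} {c : ι → ℝ≥0}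
    (hV : ∀ i, HasLaw (V i) Po(ℝ≥0∞, c i) P) (hind : iIndepFun V P) (s : Finset ι) :
    HasLaw (fun ω => ∑ i ∈ s, V i ω) Po(ℝ≥0∞, ∑ i ∈ s, c i) P := by
  classical
  have := hind.isProbabilityMeasure
  induction s using Finset.induction_on with
  | empty =>
    simp only [Finset.sum_empty, map_natCast_poissonMeasure_zero]
    exact hasLaw_dirac_of_ae_eq .rfl
  | insert j s hj ih =>
    have hi : IndepFun (V j) (fun ω => ∑ i ∈ s, V i ω) P := by
      have := (hind.indepFun_finsetSum_of_notMem₀ (fun i => (hV i).aemeasurable) hj).symm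
      simpa [Finset.sum_fn] using this
    have := hi.hasLaw_add_map_cast_poissonMeasure (hV j) ih
    simpa [Finset.sum_insert hj, Pi.add_def] using this

end PoissonLaw

section BoundedSupport

variable {E : Type*} [MeasurableSpace E] {μ : Measure E} {f : E → ℝ} {C : ℝ}

theorem integrable_of_abs_le_of_support (hf : Measurable f) (hC : ∀ x, |f x| ≤ C)
    (hμ : μ (Function.support f) < ∞) : Integrable f μ := by
  rw [← integrableOn_iff_integrable_of_support_subset subset_rfl]
  exact Measure.integrableOn_of_bounded hμ.ne hf.aestronglyMeasurable (.of_forall hC)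

theorem abs_integral_le_mul_measureReal {S : Set E} (hC : ∀ x, |f x| ≤ C)
    (hS : Function.support f ⊆ S) (hμ : μ S < ∞) : |∫ x, f x ∂μ| ≤ C * μ.real S := by
  rw [← setIntegral_eq_integral_of_forall_compl_eq_zero
    fun x hx => Function.notMem_support.1 fun h => hx (hS h)]
  exact norm_setIntegral_le_of_norm_le_const (f := f) hμ fun x _ => hC x

theorem integral_comp_simpleFunc (f : SimpleFunc E ℝ) {g : ℝ → ℝ} (hg : g 0 = 0)
    (hμ : μ (Function.support f) < ∞) :
    ∫ x, g (f x) ∂μ = ∑ c : f.range, g c * μ.real (f ⁻¹' {(c : ℝ)}) := by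
  have hfin : f.FinMeasSupp μ := SimpleFunc.finMeasSupp_iff_support.2 hμ
  have hint : Integrable f μ := SimpleFunc.integrable_iff_finMeasSupp.2 hfin
  have hint_map : Integrable (f.map g) μ :=
    SimpleFunc.integrable_iff_finMeasSupp.2 (hfin.map hg)
  calc ∫ x, g (f x) ∂μ = (f.map g).integral μ :=
        (SimpleFunc.integral_eq_integral _ hint_map).symm
    _ = ∑ c ∈ f.range, g c * μ.real (f ⁻¹' {c}) := by
        simp only [SimpleFunc.map_integral f g hint hg, smul_eq_mul, mul_comm]
    _ = _ := (Finset.sum_coe_sort f.range fun c => g c * μ.real (f ⁻¹' {c})).symm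

theorem tendsto_integral_exp_sub_one {g : ℕ → SimpleFunc E ℝ} (hgC : ∀ k x, |g k x| ≤ C)
    (hgf : ∀ k, Function.support (g k) ⊆ Function.support f) (hf : Measurable f)
    (hlim : ∀ x, Tendsto (fun k => g k x) atTop (𝓝 (f x)))
    (hμ : μ (Function.support f) < ∞) :
    Tendsto (fun k => ∫ x, (Real.exp (g k x) - 1) ∂μ) atTop
      (𝓝 (∫ x, (Real.exp (f x) - 1) ∂μ)) := by
  have hS : MeasurableSet (Function.support f) := measurableSet_support hf
  refine tendsto_integral_of_dominated_convergence
    ((Function.support f).indicator fun _ => Real.exp C + 1)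
    (fun k => ((g k).measurable.exp.sub_const 1).aestronglyMeasurable)
    ((integrable_indicator_iff hS).2 (integrableOn_const hμ.ne))
    (fun k => .of_forall fun x => ?_)
    (.of_forall fun x => ((Real.continuous_exp.tendsto _).comp (hlim x)).sub_const 1)
  by_cases hx : x ∈ Function.support f
  · rw [Set.indicator_of_mem hx]
    calc |Real.exp (g k x) - 1| ≤ |Real.exp (g k x)| + |1| := abs_sub _ _
      _ ≤ Real.exp C + 1 := by
        rw [Real.abs_exp, abs_one]
        gcongr
        exact (le_abs_self _).trans (hgC k x)
  · have hgx : g k x = 0 := Function.notMem_support.1 fun h => hx (hgf k h)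
    simp [hgx, hx]

variable {Ω : Type*} [MeasurableSpace Ω] {P : Measure Ω} {η : Ω → Measure E}

theorem aemeasurable_integral (hη : Measurable η) (hf : Measurable f)
    (hint : ∀ᵐ ω ∂P, Integrable f (η ω)) : AEMeasurable (fun ω => ∫ x, f x ∂(η ω)) P := by
  refine AEMeasurable.congr (f := fun ω => (∫⁻ x, ENNReal.ofReal (f x) ∂(η ω)).toReal -
    (∫⁻ x, ENNReal.ofReal (-f x) ∂(η ω)).toReal) (Measurable.aemeasurable ?_) ?_
  · exact ((Measure.measurable_lintegral hf.ennreal_ofReal).comp hη).ennreal_toReal.sub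
      ((Measure.measurable_lintegral hf.neg.ennreal_ofReal).comp hη).ennreal_toReal
  · filter_upwards [hint] with ω hω
    exact (integral_eq_lintegral_pos_part_sub_lintegral_neg_part hω).symm

end BoundedSupport

namespace IsPoissonProcess

variable {Ω E : Type*} [MeasurableSpace Ω] [PseudoMetricSpace E] [MeasurableSpace E]
  {P : Measure Ω} {Λ : Measure E} {η : Ω → Measure E}

theorem measurable_apply (h : IsPoissonProcess P Λ η) {B : Set E} (hB : MeasurableSet B) :
    Measurable fun ω => η ω B :=
  (Measure.measurable_coe hB).comp h.measurable

theorem ae_apply_lt_top (h : IsPoissonProcess P Λ η) {B : Set E} (hB : MeasurableSet B)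
    (hΛ : Λ B < ∞) : ∀ᵐ ω ∂P, η ω B < ∞ := by
  filter_upwards [ae_eq_floor_toReal_of_hasLaw (h.hasLaw B hB hΛ)] with ω hω
  rw [hω]
  exact ENNReal.natCast_lt_top _

theorem iIndepFun_apply (h : IsPoissonProcess P Λ η) {ι : Type*} [Finite ι] {B : ι → Set E}
    (hB : ∀ i, MeasurableSet (B i)) (hd : Pairwise fun i j => Disjoint (B i) (B j)) :
    iIndepFun (fun i ω => η ω (B i)) P := by
  let e := Finite.equivFin ι
  have := h.indep (Nat.card ι) (fun i => B (e.symm i)) (fun i => hB _)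
    fun i j hij => hd (e.symm.injective.ne hij)
  simpa using this.precomp e.injective

theorem exp_mul_real_ae_eq (h : IsPoissonProcess P Λ η) {B : Set E} (hB : MeasurableSet B)
    (hΛ : Λ B < ∞) (t : ℝ) :
    (fun ω => Real.exp (t * (η ω).real B)) =ᵐ[P]
      fun ω => Real.exp t ^ ⌊(η ω B).toReal⌋₊ := by
  filter_upwards [ae_eq_floor_toReal_of_hasLaw (h.hasLaw B hB hΛ)] with ω hω
  rw [← Real.exp_nat_mul, mul_comm, measureReal_def]
  exact congrArg (fun x : ℝ≥0∞ => Real.exp (x.toReal * t)) hω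

theorem integrable_exp_mul_real (h : IsPoissonProcess P Λ η) {B : Set E} (hB : MeasurableSet B)
    (hΛ : Λ B < ∞) (t : ℝ) : Integrable (fun ω => Real.exp (t * (η ω).real B)) P :=
  (integrable_pow_floor_of_hasLaw (h.hasLaw B hB hΛ) _).congr (h.exp_mul_real_ae_eq hB hΛ t).symm

theorem integral_exp_mul_real (h : IsPoissonProcess P Λ η) {B : Set E} (hB : MeasurableSet B)
    (hΛ : Λ B < ∞) (t : ℝ) :
    ∫ ω, Real.exp (t * (η ω).real B) ∂P = Real.exp ((Real.exp t - 1) * Λ.real B) := by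
  rw [integral_congr_ae (h.exp_mul_real_ae_eq hB hΛ t),
    integral_pow_floor_of_hasLaw (h.hasLaw B hB hΛ), mul_comm]
  rfl

theorem integral_exp_integral_simpleFunc (h : IsPoissonProcess P Λ η) (f : SimpleFunc E ℝ)
    (hΛ : Λ (Function.support f) < ∞) :
    ∫ ω, Real.exp (∫ x, f x ∂(η ω)) ∂P = Real.exp (∫ x, (Real.exp (f x) - 1) ∂Λ) := by
  have hprod : (fun ω => Real.exp (∫ x, f x ∂(η ω))) =ᵐ[P] fun ω =>
      ∏ c : f.range, Real.exp (c * (η ω (f ⁻¹' {(c : ℝ)})).toReal) := by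
    filter_upwards [h.ae_apply_lt_top f.measurableSet_support hΛ] with ω hω
    rw [integral_comp_simpleFunc f (g := fun c => c) rfl hω, Real.exp_sum]
    rfl
  have hind : iIndepFun (fun (c : f.range) ω => η ω (f ⁻¹' {(c : ℝ)})) P :=
    h.iIndepFun_apply (fun c => f.measurableSet_fiber _) fun c d hcd =>
      Disjoint.preimage f (Set.disjoint_singleton.2 (Subtype.coe_ne_coe.2 hcd))
  have hfactor (c : f.range) : ∫ ω, Real.exp (c * (η ω (f ⁻¹' {(c : ℝ)})).toReal) ∂P =
      Real.exp ((Real.exp c - 1) * Λ.real (f ⁻¹' {(c : ℝ)})) := by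
    have := hind.isProbabilityMeasure
    rcases eq_or_ne (c : ℝ) 0 with hc | hc
    · simp [hc]
    · refine h.integral_exp_mul_real (f.measurableSet_fiber _) ((measure_mono ?_).trans_lt hΛ) c
      intro x hx
      rwa [Function.mem_support, Set.mem_singleton_iff.1 hx]
  rw [integral_congr_ae hprod, hind.integral_fun_prod_comp
    (f := fun (c : f.range) (x : ℝ≥0∞) => Real.exp (c * x.toReal))
    (fun c => (h.measurable_apply (f.measurableSet_fiber _)).aemeasurable)
    (fun c => Measurable.aestronglyMeasurable (by fun_prop)),
    Finset.prod_congr rfl fun c _ => hfactor c, ← Real.exp_sum,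
    integral_comp_simpleFunc f (g := fun c => Real.exp c - 1) (by simp) hΛ]

variable {f : E → ℝ} {C : ℝ}

theorem integrable_exp_integral (h : IsPoissonProcess P Λ η) (hf : Measurable f)
    (hC : ∀ x, |f x| ≤ C) (hΛ : Λ (Function.support f) < ∞) :
    Integrable (fun ω => Real.exp (∫ x, f x ∂(η ω))) P := by
  have hS : MeasurableSet (Function.support f) := measurableSet_support hf
  have hfin := h.ae_apply_lt_top hS hΛ
  refine (h.integrable_exp_mul_real hS hΛ C).mono' (Real.measurable_exp.comp_aemeasurable
    (aemeasurable_integral h.measurable hf ?_)).aestronglyMeasurable ?_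
  · filter_upwards [hfin] with ω hω using integrable_of_abs_le_of_support hf hC hω
  · filter_upwards [hfin] with ω hω
    rw [Real.norm_eq_abs, Real.abs_exp]
    exact Real.exp_le_exp.2 <| (le_abs_self _).trans <|
      abs_integral_le_mul_measureReal hC subset_rfl hω

/- Simple functions `g k → f` with `|g k| ≤ 2 |f|` do not enlarge the support, so that
`exp (2 C * η (support f))` dominates both sides. -/
theorem integral_exp_integral (h : IsPoissonProcess P Λ η) (hf : Measurable f)
    (hC : ∀ x, |f x| ≤ C) (hΛ : Λ (Function.support f) < ∞) :
    ∫ ω, Real.exp (∫ x, f x ∂(η ω)) ∂P = Real.exp (∫ x, (Real.exp (f x) - 1) ∂Λ) := by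
  let g (k : ℕ) : SimpleFunc E ℝ := SimpleFunc.approxOn f hf Set.univ 0 trivial k
  have hg (k : ℕ) (x : E) : |g k x| ≤ |f x| + |f x| := SimpleFunc.norm_approxOn_zero_le hf _ x k
  have hgC (k : ℕ) (x : E) : |g k x| ≤ C + C := (hg k x).trans (add_le_add (hC x) (hC x))
  have hgf (k : ℕ) : Function.support (g k) ⊆ Function.support f := fun x hx hfx =>
    hx (by simpa [hfx] using hg k x)
  have hlim (x : E) : Tendsto (fun k => g k x) atTop (𝓝 (f x)) :=
    SimpleFunc.tendsto_approxOn hf (Set.mem_univ 0) (by simp)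
  have hS : MeasurableSet (Function.support f) := measurableSet_support hf
  have hfin : ∀ᵐ ω ∂P, η ω (Function.support f) < ∞ := h.ae_apply_lt_top hS hΛ
  have hleft : Tendsto (fun k => ∫ ω, Real.exp (∫ x, g k x ∂(η ω)) ∂P) atTop
      (𝓝 (∫ ω, Real.exp (∫ x, f x ∂(η ω)) ∂P)) := by
    refine tendsto_integral_of_dominated_convergence
      (fun ω => Real.exp ((C + C) * (η ω).real (Function.support f)))
      (fun k => (h.integrable_exp_integral (g k).measurable (hgC k)
        ((measure_mono (hgf k)).trans_lt hΛ)).aestronglyMeasurable)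
      (h.integrable_exp_mul_real hS hΛ _) (fun k => ?_) ?_
    · filter_upwards [hfin] with ω hω
      rw [Real.norm_eq_abs, Real.abs_exp]
      exact Real.exp_le_exp.2 <| (le_abs_self _).trans <|
        abs_integral_le_mul_measureReal (hgC k) (hgf k) hω
    · filter_upwards [hfin] with ω hω
      have hint : Integrable f (η ω) := integrable_of_abs_le_of_support hf hC hω
      exact (Real.continuous_exp.tendsto _).comp (tendsto_integral_of_dominated_convergence _
        (fun k => (g k).aestronglyMeasurable) (hint.abs.add hint.abs)
        (fun k => .of_forall (hg k)) (.of_forall hlim))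
  simp_rw [h.integral_exp_integral_simpleFunc (g _) ((measure_mono (hgf _)).trans_lt hΛ)] at hleft
  exact tendsto_nhds_unique hleft ((Real.continuous_exp.tendsto _).comp
    (tendsto_integral_exp_sub_one hgC hgf hf hlim hΛ))

end IsPoissonProcess

section MixedPoisson

variable {Ω Ω' : Type*} [MeasurableSpace Ω] [MeasurableSpace Ω'] {P : Measure Ω} {Q : Measure Ω'}
  [SFinite Q] {V : Ω × Ω' → ℝ≥0∞} {S : Ω → ℝ≥0}

theorem ae_eq_floor_toReal_of_ae_hasLaw (hV : AEMeasurable V (P.prod Q))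
    (hlaw : ∀ᵐ ω ∂P, HasLaw (fun ω' => V (ω, ω')) Po(ℝ≥0∞, S ω) Q) :
    ∀ᵐ p ∂(P.prod Q), V p = (⌊(V p).toReal⌋₊ : ℝ≥0∞) := by
  obtain ⟨W, hW, hVW⟩ := hV
  have hs : MeasurableSet {p | W p = (⌊(W p).toReal⌋₊ : ℝ≥0∞)} :=
    measurableSet_eq_fun hW (by fun_prop)
  have hWfloor : ∀ᵐ p ∂(P.prod Q), W p = (⌊(W p).toReal⌋₊ : ℝ≥0∞) := by
    rw [Measure.ae_prod_iff_ae_ae hs]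
    filter_upwards [hlaw, Measure.ae_ae_of_ae_prod hVW] with ω hω hVWω
    filter_upwards [ae_eq_floor_toReal_of_hasLaw hω, hVWω] with ω' h h'
    rwa [← h']
  filter_upwards [hWfloor, hVW] with p h h'
  rwa [h']

theorem integrable_pow_floor_of_ae_hasLaw (hV : AEMeasurable V (P.prod Q))
    (hlaw : ∀ᵐ ω ∂P, HasLaw (fun ω' => V (ω, ω')) Po(ℝ≥0∞, S ω) Q) {s : ℝ}
    (hS : Integrable (fun ω => Real.exp (S ω * (|s| - 1))) P) :
    Integrable (fun p => s ^ ⌊(V p).toReal⌋₊) (P.prod Q) := by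
  have hm : AEStronglyMeasurable (fun p => s ^ ⌊(V p).toReal⌋₊) (P.prod Q) :=
    AEMeasurable.aestronglyMeasurable (by fun_prop)
  rw [integrable_prod_iff hm]
  constructor
  · filter_upwards [hlaw] with ω hω using integrable_pow_floor_of_hasLaw hω s
  · refine hS.congr ?_
    filter_upwards [hlaw] with ω hω
    simp only [norm_pow, Real.norm_eq_abs, integral_pow_floor_of_hasLaw hω]

theorem integral_pow_floor_of_ae_hasLaw [SFinite P] (hV : AEMeasurable V (P.prod Q))
    (hlaw : ∀ᵐ ω ∂P, HasLaw (fun ω' => V (ω, ω')) Po(ℝ≥0∞, S ω) Q) {s : ℝ}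
    (hS : Integrable (fun ω => Real.exp (S ω * (|s| - 1))) P) :
    ∫ p, s ^ ⌊(V p).toReal⌋₊ ∂(P.prod Q) = ∫ ω, Real.exp (S ω * (s - 1)) ∂P := by
  rw [integral_prod _ (integrable_pow_floor_of_ae_hasLaw hV hlaw hS)]
  refine integral_congr_ae ?_
  filter_upwards [hlaw] with ω hω using integral_pow_floor_of_hasLaw hω s

end MixedPoisson

section Decoupling

variable {Ω α β : Type*} [MeasurableSpace Ω] [MeasurableSpace α] [MeasurableSpace β]
  {P : Measure Ω} [IsProbabilityMeasure P] {X : Ω → α} {Y : Ω → β}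

theorem identDistrib_prodMk_prod (hX : Measurable X) (hY : Measurable Y) (h : IndepFun X Y P) :
    IdentDistrib (fun ω => (X ω, Y ω)) (fun p : Ω × Ω => (X p.1, Y p.2)) P (P.prod P) where
  aemeasurable_fst := (hX.prodMk hY).aemeasurable
  aemeasurable_snd := by fun_prop
  map_eq := (h.map_prod_eq_prod_map_map hX.aemeasurable hY.aemeasurable).trans
    (Measure.map_prod_map P P hX hY)

end Decoupling

section ClusterUnion

variable {E : Type*} [MeasurableSpace E]

/-- The kernel sending a measure `m` on `E` to its normalization `(m univ)⁻¹ • m`, which is zero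
when `m univ = ∞`. Unlike `id`, it is a finite kernel, which gives access to the measurability of
`p ↦ m {y | (p, y) ∈ T}` jointly in `p` and `m`. -/
noncomputable def normalizationKernel (E : Type*) [MeasurableSpace E] : Kernel (Measure E) E where
  toFun m := (m Set.univ)⁻¹ • m
  measurable' := Measure.measurable_of_measurable_coe _ fun _ hs =>
    (Measure.measurable_coe .univ).inv.mul (Measure.measurable_coe hs)

instance : IsFiniteKernel (normalizationKernel E) :=
  ⟨⟨1, ENNReal.one_lt_top, fun m => ENNReal.inv_mul_le_one (m Set.univ)⟩⟩

theorem univ_mul_normalizationKernel (m : Measure E) [IsFiniteMeasure m] (A : Set E) :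
    m Set.univ * normalizationKernel E m A = m A := by
  change m Set.univ * ((m Set.univ)⁻¹ * m A) = m A
  rcases eq_or_ne (m Set.univ) 0 with h | h
  · rw [h, zero_mul, measure_mono_null (Set.subset_univ A) h]
  · rw [← mul_assoc, ENNReal.mul_inv_cancel h (measure_ne_top m _), one_mul]

variable [AddGroup E] [MeasurableAdd₂ E] {B : Set E}

theorem clusterUnion_apply (x : ℕ → E) (d : ℕ → Measure E) (hB : MeasurableSet B) :
    clusterUnion x d B = ∑' i, d i ((x i + ·) ⁻¹' B) := by
  rw [clusterUnion, Measure.sum_apply _ hB]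
  exact tsum_congr fun i => Measure.map_apply (measurable_const_add (x i)) hB

theorem aemeasurable_clusterUnion_apply {μ : Measure ((ℕ → E) × (ℕ → Measure E))}
    (hμ : ∀ᵐ p ∂μ, ∀ i, IsFiniteMeasure (p.2 i)) (hB : MeasurableSet B) :
    AEMeasurable (fun p => clusterUnion p.1 p.2 B) μ := by
  have hpre : MeasurableSet {q : (E × Measure E) × E | q.1.1 + q.2 ∈ B} :=
    (measurable_fst.fst.add measurable_snd) hB
  have hjoint : Measurable fun q : E × Measure E =>
      q.2 Set.univ * normalizationKernel E q.2 ((q.1 + ·) ⁻¹' B) :=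
    ((Measure.measurable_coe .univ).comp measurable_snd).mul
      (Kernel.measurable_kernel_prodMk_left
        (κ := (normalizationKernel E).comap Prod.snd measurable_snd) hpre)
  have hpair (i : ℕ) : Measurable fun p : (ℕ → E) × (ℕ → Measure E) => (p.1 i, p.2 i) := by
    fun_prop
  refine ⟨fun p => ∑' i, p.2 i Set.univ * normalizationKernel E (p.2 i) ((p.1 i + ·) ⁻¹' B),
    Measurable.tsum fun i => hjoint.comp (hpair i), ?_⟩
  filter_upwards [hμ] with p hp
  rw [clusterUnion_apply _ _ hB]
  exact tsum_congr fun i => (univ_mul_normalizationKernel (p.2 i) _).symm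

end ClusterUnion

section ParentSums

variable {E : Type*} {c : E → ℝ≥0} {K : ℝ≥0}

theorem abs_coe_mul_le (hK : ∀ x, c x ≤ K) (a : ℝ) (x : E) : |(c x * a : ℝ)| ≤ K * |a| := by
  rw [abs_mul, NNReal.abs_eq]
  gcongr
  exact hK x

variable [MeasurableSpace E] {Λ : Measure E}

theorem measure_support_coe_mul_lt_top (hΛ : Λ (Function.support c) < ∞) (a : ℝ) :
    Λ (Function.support fun x => (c x * a : ℝ)) < ∞ := by
  refine (measure_mono fun x hx => ?_).trans_lt hΛ
  exact fun hc => hx (by simp [hc])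

theorem finite_setOf_mem_of_sum_dirac_lt_top {x : ℕ → E} {W : Set E} (hW : MeasurableSet W)
    (h : Measure.sum (fun i => Measure.dirac (x i)) W < ∞) : {i | x i ∈ W}.Finite := by
  rw [Measure.sum_apply _ hW] at h
  refine (ENNReal.finite_const_le_of_tsum_ne_top h.ne one_ne_zero).subset fun i hi => ?_
  have hi : x i ∈ W := hi
  simp [Measure.dirac_apply' _ hW, hi]

variable [MeasurableSingletonClass E]

theorem integral_sum_dirac_eq_tsum_mul (x : ℕ → E) (a : ℝ) :
    ∫ y, (c y * a : ℝ) ∂(Measure.sum fun i => Measure.dirac (x i)) =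
      (∑' i, c (x i) : ℝ≥0) * a := by
  have h := integral_sum_dirac (x := x) (c := fun _ => 1) (f := fun y => (c y : ℝ))
    fun _ => ENNReal.one_ne_top
  rw [integral_mul_const, NNReal.coe_tsum]
  simpa using congrArg (· * a) h

variable [PseudoMetricSpace E] {Ω : Type*} [MeasurableSpace Ω] {P : Measure Ω}
  {X : ℕ → Ω → E}

theorem integrable_exp_tsum_mul
    (hη : IsPoissonProcess P Λ fun ω => Measure.sum fun i => Measure.dirac (X i ω))
    (hc : Measurable c) (hK : ∀ x, c x ≤ K) (hΛ : Λ (Function.support c) < ∞) (a : ℝ) :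
    Integrable (fun ω => Real.exp ((∑' i, c (X i ω) : ℝ≥0) * a)) P := by
  simpa only [integral_sum_dirac_eq_tsum_mul] using hη.integrable_exp_integral
    (hc.coe_nnreal_real.mul_const a) (abs_coe_mul_le hK a) (measure_support_coe_mul_lt_top hΛ a)

theorem integral_exp_tsum_mul
    (hη : IsPoissonProcess P Λ fun ω => Measure.sum fun i => Measure.dirac (X i ω))
    (hc : Measurable c) (hK : ∀ x, c x ≤ K) (hΛ : Λ (Function.support c) < ∞) (a : ℝ) :
    ∫ ω, Real.exp ((∑' i, c (X i ω) : ℝ≥0) * a) ∂P =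
      Real.exp (∫ x, (Real.exp (c x * a) - 1) ∂Λ) := by
  simpa only [integral_sum_dirac_eq_tsum_mul] using hη.integral_exp_integral
    (hc.coe_nnreal_real.mul_const a) (abs_coe_mul_le hK a) (measure_support_coe_mul_lt_top hΛ a)

end ParentSums

section NeymanScott

variable {E : Type*} [AddGroup E] [MeasurableSpace E]

/-- The mean number of points in `B` of a cluster with intensity measure `M` translated to `x`.
It is `0` when that mean is infinite. -/
def clusterMean (M : Measure E) (B : Set E) (x : E) : ℝ≥0 :=
  (M ((x + ·) ⁻¹' B)).toNNReal

/-- `Φ` is a Neyman–Scott process: a superposition of independent Poisson clusters with intensity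
measure `M`, translated to the points `X i` of a Poisson process with intensity measure `Λ` that is
independent of the clusters. -/
def IsNeymanScottProcess {Ω : Type*} [MeasurableSpace Ω] [PseudoMetricSpace E] (P : Measure Ω)
    (Λ M : Measure E) (Φ : Ω → Measure E) : Prop :=
  ∃ (X : ℕ → Ω → E) (D : ℕ → Ω → Measure E),
    (∀ i, Measurable (X i)) ∧
    IsPoissonProcess P Λ (fun ω => Measure.sum fun i => Measure.dirac (X i ω)) ∧
    (∀ i, IsPoissonProcess P M (D i)) ∧
    iIndepFun D P ∧
    IndepFun (fun ω i => X i ω) (fun ω i => D i ω) P ∧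
    ∀ᵐ ω ∂P, Φ ω = clusterUnion (fun i => X i ω) (fun i => D i ω)

variable {M : Measure E} [IsFiniteMeasure M] {B : Set E}

theorem clusterMean_le (x : E) : clusterMean M B x ≤ (M Set.univ).toNNReal :=
  ENNReal.toNNReal_mono (measure_ne_top M _) (measure_mono (Set.subset_univ _))

variable [MeasurableAdd₂ E]

theorem measurable_clusterMean (hB : MeasurableSet B) : Measurable (clusterMean M B) :=
  (measurable_measure_prodMk_left (measurable_add hB)).ennreal_toNNReal

variable {Ω : Type*} [MeasurableSpace Ω] {P : Measure Ω} [PseudoMetricSpace E] {Λ : Measure E}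
  {X : ℕ → Ω → E} {D : ℕ → Ω → Measure E}

theorem hasLaw_clusterUnion_apply (hD : ∀ i, IsPoissonProcess P M (D i)) (hind : iIndepFun D P)
    (hB : MeasurableSet B) {x : ℕ → E}
    (hfin : (Function.support fun i => clusterMean M B (x i)).Finite) :
    HasLaw (fun ω => clusterUnion x (fun i => D i ω) B)
      Po(ℝ≥0∞, ∑' i, clusterMean M B (x i)) P := by
  have hpre (i : ℕ) : MeasurableSet ((x i + ·) ⁻¹' B) := measurable_const_add (x i) hB
  have hlaw (i : ℕ) : HasLaw (fun ω => D i ω ((x i + ·) ⁻¹' B))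
      Po(ℝ≥0∞, clusterMean M B (x i)) P :=
    (hD i).hasLaw _ (hpre i) (measure_lt_top M _)
  have hcount : iIndepFun (fun i ω => D i ω ((x i + ·) ⁻¹' B)) P :=
    hind.comp (fun i (m : Measure E) => m ((x i + ·) ⁻¹' B))
      fun i => Measure.measurable_coe (hpre i)
  have hempty : ∀ᵐ ω ∂P, ∀ i ∉ hfin.toFinset, D i ω ((x i + ·) ⁻¹' B) = 0 := by
    refine ae_all_iff.2 fun i => ?_
    by_cases hi : clusterMean M B (x i) = 0
    · filter_upwards [ae_eq_zero_of_hasLaw_poisson_zero (hi ▸ hlaw i)] with ω hω _ using hω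
    · exact .of_forall fun ω h => absurd (hfin.mem_toFinset.2 hi) h
  rw [tsum_eq_sum (s := hfin.toFinset) fun i hi => by simpa using hi]
  refine (hasLaw_finsetSum_poisson hlaw hcount hfin.toFinset).congr ?_
  filter_upwards [hempty] with ω hω
  rw [clusterUnion_apply _ _ hB, tsum_eq_sum hω]

theorem ae_hasLaw_clusterUnion_apply
    (hη : IsPoissonProcess P Λ fun ω => Measure.sum fun i => Measure.dirac (X i ω))
    (hD : ∀ i, IsPoissonProcess P M (D i)) (hind : iIndepFun D P) (hB : MeasurableSet B)
    (hΛ : Λ (Function.support (clusterMean M B)) < ∞) :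
    ∀ᵐ ω ∂P, HasLaw (fun ω' => clusterUnion (fun i => X i ω) (fun i => D i ω') B)
      Po(ℝ≥0∞, ∑' i, clusterMean M B (X i ω)) P := by
  have hS : MeasurableSet (Function.support (clusterMean M B)) :=
    measurableSet_support (measurable_clusterMean hB)
  filter_upwards [hη.ae_apply_lt_top hS hΛ] with ω hω
  exact hasLaw_clusterUnion_apply hD hind hB (finite_setOf_mem_of_sum_dirac_lt_top hS hω)

theorem identDistrib_clusterUnion_apply [IsProbabilityMeasure P] (hX : ∀ i, Measurable (X i))
    (hD : ∀ i, IsPoissonProcess P M (D i))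
    (hXD : IndepFun (fun ω i => X i ω) (fun ω i => D i ω) P) (hB : MeasurableSet B) :
    IdentDistrib (fun ω => clusterUnion (fun i => X i ω) (fun i => D i ω) B)
      (fun p : Ω × Ω => clusterUnion (fun i => X i p.1) (fun i => D i p.2) B) P (P.prod P) := by
  have hDm (i : ℕ) : Measurable (D i) := (hD i).measurable
  have hfin : ∀ᵐ ω ∂P, ∀ i, D i ω Set.univ < ∞ :=
    ae_all_iff.2 fun i => (hD i).ae_apply_lt_top .univ (measure_lt_top M _)
  have hs : MeasurableSet {p : (ℕ → E) × (ℕ → Measure E) | ∀ i, p.2 i Set.univ < ∞} := by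
    refine Set.ofPred_forall _ ▸ .iInter fun i => measurableSet_lt ?_ measurable_const
    exact (Measure.measurable_coe .univ).comp ((measurable_pi_apply i).comp measurable_snd)
  refine (identDistrib_prodMk_prod (measurable_pi_lambda _ hX) (measurable_pi_lambda _ hDm)
    hXD).comp_of_aemeasurable (aemeasurable_clusterUnion_apply ?_ hB)
  filter_upwards [(ae_map_iff (by fun_prop) hs).2 hfin] with p hp i using ⟨hp i⟩

end NeymanScott

section Radial

variable {E : Type*} [NormedAddCommGroup E] [NormedSpace ℝ E] [FiniteDimensional ℝ E]
  [MeasurableSpace E] [BorelSpace E] [Nontrivial E] (μ : Measure E) [μ.IsAddHaarMeasure]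
  {R : ℝ}

theorem setIntegral_closedBall_fun_norm (u : ℝ → ℝ) (hR : 0 ≤ R) :
    ∫ x in closedBall 0 R, u ‖x‖ ∂μ = μ.real (ball 0 1) *
      ∫ x in (0 : ℝ)..R, Module.finrank ℝ E * u x * x ^ (Module.finrank ℝ E - 1) := by
  have hball : (closedBall (0 : E) R).indicator (fun x => u ‖x‖) =
      fun x => (Set.Iic R).indicator u ‖x‖ := by
    ext x
    by_cases hx : ‖x‖ ≤ R <;> simp [hx]
  have hradius : (fun y : ℝ => y ^ (Module.finrank ℝ E - 1) • (Set.Iic R).indicator u y) =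
      (Set.Iic R).indicator fun y => y ^ (Module.finrank ℝ E - 1) * u y := by
    ext y
    simp only [Set.indicator_apply, smul_eq_mul, mul_ite, mul_zero]
  rw [← integral_indicator measurableSet_closedBall, hball, integral_fun_norm_addHaar, hradius,
    setIntegral_indicator measurableSet_Iic, Set.Ioi_inter_Iic,
    ← intervalIntegral.integral_of_le hR, nsmul_eq_mul, smul_eq_mul, mul_left_comm,
    ← intervalIntegral.integral_const_mul]
  simp only [← mul_assoc, mul_right_comm _ _ (u _)]

theorem integral_fun_norm_sub_one {u : ℝ → ℝ} (hR : 0 ≤ R) (hu : ∀ x, R < x → u x = 1)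
    (hint : IntegrableOn (fun x => u ‖x‖) (closedBall 0 R) μ) :
    ∫ x, (u ‖x‖ - 1) ∂μ = μ.real (ball 0 1) *
      ((∫ x in (0 : ℝ)..R, Module.finrank ℝ E * u x * x ^ (Module.finrank ℝ E - 1)) -
        R ^ Module.finrank ℝ E) := by
  have hzero (x : E) (hx : x ∉ closedBall 0 R) : u ‖x‖ - 1 = 0 := by
    rw [mem_closedBall_zero_iff, not_le] at hx
    rw [hu _ hx, sub_self]
  rw [← setIntegral_eq_integral_of_forall_compl_eq_zero hzero,
    integral_sub hint (integrableOn_const measure_closedBall_lt_top.ne),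
    setIntegral_closedBall_fun_norm μ u hR, setIntegral_const, smul_eq_mul, mul_one,
    Measure.addHaar_real_closedBall μ 0 hR, mul_sub, mul_comm (μ.real _)]
  ring

end Radial

section Matern

theorem volume_real_ball_zero_one (n : ℕ) [NeZero n] :
    (volume : Measure (EuclideanSpace ℝ (Fin n))).real (ball 0 1) = unitBallVolume n := by
  have hpow : √Real.pi ^ n = Real.pi ^ ((n : ℝ) / 2) := by
    rw [Real.sqrt_eq_rpow, ← Real.rpow_natCast, ← Real.rpow_mul Real.pi_pos.le, one_div_mul_eq_div]
  rw [measureReal_def, EuclideanSpace.volume_ball, Fintype.card_fin, hpow, ENNReal.ofReal_one,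
    one_pow, one_mul]
  exact ENNReal.toReal_ofReal
    (div_nonneg (by positivity) (Real.Gamma_pos_of_pos (by positivity)).le)

variable {n : ℕ} [NeZero n] {r rd lamP lamD : ℝ}

/-- The intensity measure of a daughter process of a Matérn cluster process: `lamD` times Lebesgue
measure on the ball `B(o, rd)`. -/
noncomputable abbrev daughterIntensity (n : ℕ) (lamD rd : ℝ) : Measure (EuclideanSpace ℝ (Fin n)) :=
  ENNReal.ofReal lamD • volume.restrict (closedBall 0 rd)

instance : IsFiniteMeasure (daughterIntensity n lamD rd) :=
  have : IsFiniteMeasure (volume.restrict (closedBall (0 : EuclideanSpace ℝ (Fin n)) rd)) :=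
    isFiniteMeasure_restrict.2 measure_closedBall_lt_top.ne
  Measure.smul_finite _ ENNReal.ofReal_ne_top

theorem interVolume_eq_zero {x : ℝ} (hx : r + rd < x) : interVolume n r rd x = 0 := by
  have hdist : r + rd < dist 0 (EuclideanSpace.single (0 : Fin n) x) := by
    simpa [dist_zero_left] using hx.trans_le (le_abs_self x)
  rw [interVolume, (closedBall_disjoint_closedBall hdist).inter_eq, measureReal_empty]

theorem clusterMean_daughterIntensity (hlamD : 0 ≤ lamD) (x : EuclideanSpace ℝ (Fin n)) :
    (clusterMean (daughterIntensity n lamD rd) (closedBall 0 r) x : ℝ) =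
      lamD * interVolume n r rd ‖x‖ := by
  have htranslate : (x + ·) ⁻¹' closedBall 0 r ∩ closedBall 0 rd =
      (x + ·) ⁻¹' (closedBall 0 r ∩ closedBall x rd) := by
    ext y
    simp only [Set.mem_inter_iff, Set.mem_preimage, mem_closedBall, dist_zero_right,
      dist_self_add_left]
  rw [clusterMean, ENNReal.coe_toNNReal_eq_toReal, Measure.smul_apply,
    Measure.restrict_apply (measurable_const_add x measurableSet_closedBall), htranslate,
    measure_preimage_add, smul_eq_mul, ENNReal.toReal_mul, ENNReal.toReal_ofReal hlamD,
    ← interVolume_norm, measureReal_def]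

theorem support_clusterMean_daughterIntensity_subset (hlamD : 0 ≤ lamD) :
    Function.support (clusterMean (daughterIntensity n lamD rd) (closedBall 0 r)) ⊆
      closedBall 0 (r + rd) := by
  intro x hx
  contrapose! hx
  rw [mem_closedBall_zero_iff, not_le] at hx
  rw [Function.notMem_support, ← NNReal.coe_eq_zero, clusterMean_daughterIntensity hlamD,
    interVolume_eq_zero hx, mul_zero]

theorem integral_exp_clusterMean_sub_one_eq_exponent (hlamP : 0 ≤ lamP) (hlamD : 0 ≤ lamD)
    (hR : 0 ≤ r + rd) (s : ℝ) :
    ∫ x, (Real.exp (clusterMean (daughterIntensity n lamD rd) (closedBall 0 r) x * (s - 1)) - 1)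
        ∂(ENNReal.ofReal lamP • volume) = exponent n lamP lamD rd r s := by
  set c := clusterMean (daughterIntensity n lamD rd) (closedBall 0 r)
  let u (x : ℝ) : ℝ := Real.exp (lamD * interVolume n r rd x * (s - 1))
  have hcu (x : EuclideanSpace ℝ (Fin n)) : Real.exp (c x * (s - 1)) = u ‖x‖ := by
    rw [clusterMean_daughterIntensity hlamD]
  have hu (x : ℝ) (hx : r + rd < x) : u x = 1 := by
    simp only [u, interVolume_eq_zero hx, mul_zero, zero_mul, Real.exp_zero]
  have hint : IntegrableOn (fun x : EuclideanSpace ℝ (Fin n) => u ‖x‖) (closedBall 0 (r + rd)) := by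
    have hc : Measurable c := measurable_clusterMean measurableSet_closedBall
    simp only [← hcu]
    refine Measure.integrableOn_of_bounded measure_closedBall_lt_top.ne
      (M := Real.exp ((daughterIntensity n lamD rd Set.univ).toNNReal * |s - 1|))
      (Measurable.aestronglyMeasurable (by fun_prop)) (.of_forall fun x => ?_)
    rw [Real.norm_eq_abs, Real.abs_exp]
    exact Real.exp_le_exp.2 ((le_abs_self _).trans (abs_coe_mul_le clusterMean_le _ x))
  simp only [hcu]
  rw [integral_smul_measure, integral_fun_norm_sub_one _ hR hu hint, volume_real_ball_zero_one,
    finrank_euclideanSpace_fin, ENNReal.toReal_ofReal hlamP, smul_eq_mul, exponent]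
  ring

end Matern

end MaternCluster

open MaternCluster in
theorem theorem1_general {Ω E : Type*} [MeasurableSpace Ω] {P : Measure Ω}
    [IsProbabilityMeasure P] [PseudoMetricSpace E] [AddGroup E] [MeasurableSpace E]
    [MeasurableAdd₂ E] [MeasurableSingletonClass E] {Λ M : Measure E} [IsFiniteMeasure M]
    {Φ : Ω → Measure E} (hΦ : IsNeymanScottProcess P Λ M Φ) {B : Set E} (hB : MeasurableSet B)
    (hΛ : Λ (Function.support (clusterMean M B)) < ∞) :
    (∀ᵐ ω ∂P, Φ ω B = (pointCount (Φ ω) B : ℝ≥0∞)) ∧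
    ∀ s : ℝ,
      Integrable (fun ω => s ^ pointCount (Φ ω) B) P ∧
      ∫ ω, s ^ pointCount (Φ ω) B ∂P =
        Real.exp (∫ x, (Real.exp (clusterMean M B x * (s - 1)) - 1) ∂Λ) := by
  obtain ⟨X, D, hX, hη, hD, hind, hXD, hsum⟩ := hΦ
  have hlaw := ae_hasLaw_clusterUnion_apply hη hD hind hB hΛ
  have hident : IdentDistrib (fun ω => Φ ω B)
      (fun p : Ω × Ω => clusterUnion (fun i => X i p.1) (fun i => D i p.2) B) P (P.prod P) := by
    have h := identDistrib_clusterUnion_apply hX hD hXD hB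
    refine .trans (.symm (.of_ae_eq h.aemeasurable_fst ?_)) h
    filter_upwards [hsum] with ω hω
    rw [hω]
  have hV := hident.aemeasurable_snd
  have hc : Measurable (clusterMean M B) := measurable_clusterMean hB
  refine ⟨hident.symm.ae_snd (p := fun v => v = (⌊v.toReal⌋₊ : ℝ≥0∞))
    (measurableSet_eq_fun measurable_id (by fun_prop)) (ae_eq_floor_toReal_of_ae_hasLaw hV hlaw),
    fun s => ?_⟩
  have hpow := hident.comp (u := fun v : ℝ≥0∞ => s ^ ⌊v.toReal⌋₊) (by fun_prop)
  have hexp := integrable_exp_tsum_mul hη hc clusterMean_le hΛ (|s| - 1)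
  exact ⟨hpow.integrable_iff.2 (integrable_pow_floor_of_ae_hasLaw hV hlaw hexp),
    hpow.integral_eq.trans <| (integral_pow_floor_of_ae_hasLaw hV hlaw hexp).trans <|
      integral_exp_tsum_mul hη hc clusterMean_le hΛ (s - 1)⟩

theorem theorem1 {Ω : Type*} [MeasurableSpace Ω] (P : Measure Ω) [IsProbabilityMeasure P]
    (n : ℕ) [NeZero n] (lamP lamD rd r : ℝ)
    (hlamP : 0 < lamP) (hlamD : 0 ≤ lamD) (hrd : 0 ≤ rd) (hr : 0 ≤ r)
    (Φ : Ω → Measure (EuclideanSpace ℝ (Fin n)))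
    (hΦ : MaternCluster.IsMaternClusterProcess P lamP lamD rd Φ) :
    (∀ᵐ ω ∂P, Φ ω (closedBall 0 r) =
      (MaternCluster.pointCount (Φ ω) (closedBall 0 r) : ℝ≥0∞)) ∧
    ∀ s : ℝ,
      Integrable (fun ω => s ^ MaternCluster.pointCount (Φ ω) (closedBall 0 r)) P ∧
      ∫ ω, s ^ MaternCluster.pointCount (Φ ω) (closedBall 0 r) ∂P =
        Real.exp (MaternCluster.exponent n lamP lamD rd r s) := by
  simp only [← MaternCluster.integral_exp_clusterMean_sub_one_eq_exponent hlamP.le hlamD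
    (add_nonneg hr hrd)]
  exact theorem1_general hΦ measurableSet_closedBall <|
    (measure_mono (MaternCluster.support_clusterMean_daughterIntensity_subset hlamD)).trans_lt <|
      ENNReal.mul_lt_top ENNReal.ofReal_lt_top measure_closedBall_lt_top
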